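/- Let $\mathcal H$ be a real separable Hilbert space with its Borel $\sigma$-algebra, and let $f:\mathcal H\to\mathbb R$ be convex and differentiable, with $L$-Lipschitz continuous gradient ($L>0$) and $\operatorname{argmin} f\neq\emptyset$. Let $s\in\,]0,1/L]$ and let $(\alpha_k)_{k\in\mathbb N}\subset[0,1]$ satisfy $$(K_0)\quad \sum_{i=k}^{+\infty}\prod_{j=k}^{i}\alpha_j<+\infty\quad\text{for all }k\ge 1 .$$ Put $t_k:=1+\sum_{i=k}^{+\infty}\prod_{j=k}^{i}\alpha_j$ for $k\in\mathbb N$, and assume that, for some $m\in[0,1[$, $$(K_1^+)\quad t_{k+1}^2-t_k^2\le m\,t_{k+1}\quad\text{for all }k\ge 1 .$$ On a probability space $(\Omega,\mathcal F,\mathbb P)$, let $y_0$ be a square-integrable $\mathcal H$-valued random variable and $(e_k)_{k\in\mathbb N}$ a sequence of integrable $\mathcal H$-valued random variables. Let $w_{-1}=y_0$ and, for all $k\ge 0$, $$w_k=y_k-s\,(\nabla f(y_k)+e_k),\qquad y_{k+1}=w_k+\alpha_{k+1}(w_k-w_{k-1}).$$ Let $\mathcal F_k:=\sigma(y_0,(w_i)_{i\le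 k-1})$ and $\sigma_k:=\mathbb E\big[\|e_k\|^2\mid\mathcal F_k\big]^{1/2}\in[0,+\infty]$, and assume that $$(K_2^+)\quad \mathbb E[e_k\mid\mathcal F_k]=0\ \text{ almost surely for all }k\in\mathbb N,\qquad\text{and}\qquad \sum_{k\in\mathbb N}s\,t_k\,\sigma_k<+\infty\ \text{ almost surely}.$$ Then, almost surely, $\nabla f(y_k)\to 0$ as $k\to+\infty$ and $$\sum_{k\in\mathbb N}t_{k+1}^2\,\|\nabla f(y_k)\|^2<+\infty .$$ -/

import Mathlib

open MeasureTheory Filter Topology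
open scoped ENNReal NNReal Gradient

/-- Condition `(K₀)`: for every `k ≥ 1` the series `∑_{i ≥ k} ∏_{j = k}^{i} α_j` converges
(the summation index below is `i - k`). -/
def CondK0 (α : ℕ → ℝ) : Prop :=
  ∀ k : ℕ, 1 ≤ k → Summable fun n : ℕ => ∏ j ∈ Finset.Icc k (k + n), α j

/-- `t_k = 1 + ∑_{i ≥ k} ∏_{j = k}^{i} α_j` (the summation index below is `i - k`). -/
noncomputable def tSeq (α : ℕ → ℝ) (k : ℕ) : ℝ :=
  1 + ∑' n : ℕ, ∏ j ∈ Finset.Icc k (k + n), α j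

/-- Condition `(K₁⁺)`: for some `m ∈ [0,1)`, `t_{k+1}² - t_k² ≤ m t_{k+1}` for every `k ≥ 1`. -/
def CondK1Plus (α : ℕ → ℝ) : Prop :=
  ∃ m : ℝ, 0 ≤ m ∧ m < 1 ∧
    ∀ k : ℕ, 1 ≤ k → tSeq α (k + 1) ^ 2 - tSeq α k ^ 2 ≤ m * tSeq α (k + 1)

section Algorithm

variable {Ω H : Type*} [NormedAddCommGroup H] [InnerProductSpace ℝ H] [CompleteSpace H]

/-- `(y, w)` is generated by the stochastic Ravine method with constant step `s`, extrapolation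
coefficients `α_{k+1}`, gradient errors `e`, and initialization `w_{-1} = y_0`:
`w_k = y_k - s (∇f(y_k) + e_k)` and `y_{k+1} = w_k + α_{k+1} (w_k - w_{k-1})` for all `k ≥ 0`. -/
structure IsSRAG (f : H → ℝ) (s : ℝ) (α : ℕ → ℝ) (e y w : ℕ → Ω → H) : Prop where
  w_eq : ∀ k ω, w k ω = y k ω - s • (∇ f (y k ω) + e k ω)
  y_one : ∀ ω, y 1 ω = w 0 ω + α 1 • (w 0 ω - y 0 ω)
  y_succ : ∀ k ω, y (k + 2) ω = w (k + 1) ω + α (k + 2) • (w (k + 1) ω - w k ω)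

variable [MeasurableSpace H]

/-- The canonical filtration `F_k = σ(y_0, (w_i)_{i ≤ k-1})`; the index `i = -1` adds nothing
because `w_{-1} = y_0`. -/
@[reducible] def sragSigma (y w : ℕ → Ω → H) (k : ℕ) : MeasurableSpace Ω :=
  MeasurableSpace.comap (y 0) inferInstance ⊔
    ⨆ i : Fin k, MeasurableSpace.comap (w i) inferInstance

variable [MeasurableSpace Ω]

/-- `σ_k = E[‖e_k‖² | F_k]^{1/2}`, with the conditional expectation of a nonnegative random
variable taken in `[0,∞]`. -/
noncomputable def sragSd (P : Measure Ω) (e y w : ℕ → Ω → H) (k : ℕ) (ω : Ω) : ℝ≥0∞ :=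
  (P⁻[fun ω' => ‖e k ω'‖ₑ ^ 2 | sragSigma y w k] ω) ^ (1 / 2 : ℝ)

/-- Condition `(K₂⁺)`: `E[e_k | F_k] = 0` a.s. for every `k` (which presupposes that `e_k` is
integrable) and `(s t_k σ_k)_k ∈ ℓ¹₊(F)`, i.e. `∑_k s t_k σ_k < ∞` a.s. -/
structure CondK2Plus (P : Measure Ω) (s : ℝ) (α : ℕ → ℝ) (e y w : ℕ → Ω → H) : Prop where
  integrable : ∀ k, Integrable (e k) P
  condExp_eq_zero : ∀ k, P[e k | sragSigma y w k] =ᵐ[P] 0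
  summable : ∀ᵐ ω ∂P, ∑' k : ℕ, ENNReal.ofReal (s * tSeq α k) * sragSd P e y w k ω < ∞

end Algorithm

/-! Shifting indices, `x_0 = y_0` and `x_{n+1} = w_n`, turns the Ravine method into Nesterov's. With
`z_n = x_n + t_{n+1}(x_{n+1} - x_n)` and a minimizer `x⋆`, the energy `s t_{n+1}²(f(x_{n+1}) -
f(x⋆)) + ‖z_n - x⋆‖²/2` decreases up to noise (`IsSRAG.energy_step`). The interpolation inequality
for smooth convex functions makes the decrease strict: it controls `t²‖∇f(x_{n+2})‖²`, `(t² -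
t)‖∇f(x_{n+1}) - ∇f(y_{n+1})‖²` and `t‖∇f(y_{n+1})‖²` with `t = t_{n+2}`. Combining gains of
consecutive steps bounds `t_{k+1}²‖∇f(y_k)‖²`.

The noise enters through an inner product with a predictable vector, of mean zero, and a multiple of
`(s t_k)²‖e_k‖²`. Since `e_k` need not be square integrable, everything is localized to the
decreasing events `D_k = {∑_{j ≤ k} s t_j σ_j ≤ K}`, which lie in `F_k`. There the quadratic noise
has total expectation at most `K²` (`sum_setIntegral_error_le`), so the expected gains are summable
and the gains are almost surely summable on `⋂ D_k`. By `(K₂⁺)`, these intersections cover almost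
all of `Ω` as `K` runs through the integers. -/

/-! ### Inequalities for smooth convex functions and the deterministic energy step. -/

section SmoothConvex

variable {H : Type*} [NormedAddCommGroup H] [InnerProductSpace ℝ H] [CompleteSpace H]

theorem hasDerivAt_comp_segment_gradient {f : H → ℝ} (hf : Differentiable ℝ f) (x d : H) (r : ℝ) :
    HasDerivAt (fun r : ℝ => f (x + r • d)) (inner ℝ (∇ f (x + r • d)) d) r := by
  have h1 : HasDerivAt (fun r : ℝ => x + r • d) d r := by
    simpa using ((hasDerivAt_id r).smul_const d).const_add x
  have h2 := (hf (x + r • d)).hasFDerivAt.comp_hasDerivAt r h1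
  rwa [inner_gradient_left]

/-- A convex differentiable function lies above its tangent hyperplanes. -/
theorem ConvexOn.add_inner_gradient_le {f : H → ℝ} (hf : Differentiable ℝ f)
    (hc : ConvexOn ℝ Set.univ f) (x z : H) : f x + inner ℝ (∇ f x) (z - x) ≤ f z := by
  have hφ : ConvexOn ℝ Set.univ (fun r : ℝ => f (x + r • (z - x))) := by
    have := hc.comp_affineMap (AffineMap.lineMap x z : ℝ →ᵃ[ℝ] H)
    simp only [Set.preimage_univ] at this
    refine this.congr fun r _ => ?_
    simp [AffineMap.lineMap_apply, add_comm]
  have hd := hasDerivAt_comp_segment_gradient hf x (z - x) 0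
  have := hφ.le_slope_of_hasDerivAt (Set.mem_univ 0) (Set.mem_univ 1) one_pos hd
  simp [slope_def_field, -inner_gradient_left] at this
  linarith

/-- The descent lemma. -/
theorem le_add_inner_gradient_add_sq {f : H → ℝ} {L : ℝ≥0} (hf : Differentiable ℝ f)
    (hL : LipschitzWith L (∇ f)) (x z : H) :
    f z ≤ f x + inner ℝ (∇ f x) (z - x) + L / 2 * ‖z - x‖ ^ 2 := by
  set d := z - x with hd
  -- The claim is `φ 1 ≤ φ 0`; the Lipschitz bound gives `φ' ≤ 0` for `r > 0`.
  let φ : ℝ → ℝ := fun r => f (x + r • d) - r * inner ℝ (∇ f x) d - L / 2 * ‖d‖ ^ 2 * r ^ 2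
  have hφ : ∀ r, HasDerivAt φ (inner ℝ (∇ f (x + r • d)) d - inner ℝ (∇ f x) d
      - L / 2 * ‖d‖ ^ 2 * (2 * r)) r := fun r => by
    have h := ((hasDerivAt_comp_segment_gradient hf x d r).sub
      ((hasDerivAt_id r).mul_const (inner ℝ (∇ f x) d))).sub
      ((hasDerivAt_pow 2 r).const_mul (L / 2 * ‖d‖ ^ 2))
    refine h.congr_deriv ?_
    simp [-inner_gradient_left]
  have hanti : AntitoneOn φ (Set.Ici 0) := by
    refine antitoneOn_of_deriv_nonpos (convex_Ici 0)
      (fun r _ => (hφ r).continuousAt.continuousWithinAt)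
      (fun r _ => (hφ r).differentiableAt.differentiableWithinAt) fun r hr => ?_
    rw [interior_Ici, Set.mem_Ioi] at hr
    rw [(hφ r).deriv, ← inner_sub_left]
    have h1 := real_inner_le_norm (∇ f (x + r • d) - ∇ f x) d
    have h2 : ‖∇ f (x + r • d) - ∇ f x‖ ≤ L * (r * ‖d‖) := by
      have := hL.norm_sub_le (x + r • d) x
      simpa [norm_smul, abs_of_pos hr] using this
    nlinarith [norm_nonneg d, mul_le_mul_of_nonneg_right h2 (norm_nonneg d)]
  have := hanti (Set.mem_Ici.2 le_rfl) (Set.mem_Ici.2 zero_le_one) zero_le_one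
  simp [φ, -inner_gradient_left] at this
  have hz : x + d = z := by simp [hd]
  rw [hz] at this
  linarith

/-- Interpolation inequality for convex functions with Lipschitz gradient. -/
theorem ConvexOn.le_add_inner_gradient_sub_sq {f : H → ℝ} {L : ℝ≥0} {s : ℝ} (hL0 : 0 < L)
    (hf : Differentiable ℝ f) (hc : ConvexOn ℝ Set.univ f) (hL : LipschitzWith L (∇ f))
    (hs : s ≤ 1 / (L : ℝ)) (x y : H) :
    f y ≤ f x + inner ℝ (∇ f y) (y - x) - s / 2 * ‖∇ f x - ∇ f y‖ ^ 2 := by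
  have hL1 : (0 : ℝ) < L := hL0
  set d := ∇ f x - ∇ f y with hd
  -- This point minimizes the gap between the quadratic upper bound at `x` and the tangent lower
  -- bound at `y`; both are evaluated there.
  set u := x - (1 / (L : ℝ)) • d with hu
  have h1 := hc.add_inner_gradient_le hf y u
  have h2 := le_add_inner_gradient_add_sq hf hL x u
  have hux : u - x = -((1 / (L : ℝ)) • d) := by simp [hu]
  have huy : u - y = (x - y) - (1 / (L : ℝ)) • d := by rw [hu]; abel
  have hyx : inner ℝ (∇ f y) (y - x) = - inner ℝ (∇ f y) (x - y) := by
    rw [← neg_sub x y, inner_neg_right]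
  have hdd : inner ℝ (∇ f x) d - inner ℝ (∇ f y) d = ‖d‖ ^ 2 := by
    rw [← inner_sub_left, ← hd, real_inner_self_eq_norm_sq]
  rw [hux, norm_neg, inner_neg_right, inner_smul_right, norm_smul, mul_pow] at h2
  rw [huy, inner_sub_right, inner_smul_right] at h1
  rw [hyx]
  have h3 : (L : ℝ) / 2 * (‖1 / (L : ℝ)‖ ^ 2 * ‖d‖ ^ 2) = 1 / (L : ℝ) * ‖d‖ ^ 2 / 2 := by
    rw [Real.norm_eq_abs, sq_abs]; field_simp
  rw [h3] at h2
  have h4 : s * ‖d‖ ^ 2 ≤ 1 / (L : ℝ) * ‖d‖ ^ 2 := by gcongr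
  have h5 : 1 / (L : ℝ) * (inner ℝ (∇ f x) d) - 1 / (L : ℝ) * inner ℝ (∇ f y) d
      = 1 / (L : ℝ) * ‖d‖ ^ 2 := by rw [← hdd]; ring
  linarith

theorem gradient_eq_zero_of_forall_le {f : H → ℝ} {x : H} (hx : ∀ z, f x ≤ f z) : ∇ f x = 0 := by
  have : fderiv ℝ f x = 0 := IsLocalMin.fderiv_eq_zero (Eventually.of_forall hx)
  simp [gradient, this]

/-- One-step decrease of the energy `s t²(f x - f x⋆) + ‖z - x⋆‖² / 2` along an inexact
accelerated gradient step. -/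
theorem ConvexOn.energy_step {f : H → ℝ} {L : ℝ≥0} {s : ℝ} (hL0 : 0 < L)
    (hf : Differentiable ℝ f) (hc : ConvexOn ℝ Set.univ f) (hL : LipschitzWith L (∇ f))
    (hs0 : 0 < s) (hs : s ≤ 1 / (L : ℝ)) {xs : H} (hxs : ∀ z, f xs ≤ f z)
    {t t' : ℝ} (ht : 1 ≤ t) (htt : t ^ 2 - t ≤ t' ^ 2) {x y x' z e : H}
    (hx' : x' = y - s • (∇ f y + e)) (hz : z = x + t • (y - x)) :
    s * t ^ 2 * (f x' - f xs) + ‖z - (s * t) • (∇ f y + e) - xs‖ ^ 2 / 2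
      + (s ^ 2 * t ^ 2 / 4 * ‖∇ f x'‖ ^ 2 + s ^ 2 * (t ^ 2 - t) / 2 * ‖∇ f x - ∇ f y‖ ^ 2
        + s ^ 2 * t / 2 * ‖∇ f y‖ ^ 2)
    ≤ s * t' ^ 2 * (f x - f xs) + ‖z - xs‖ ^ 2 / 2
      + inner ℝ ((s ^ 2 * t ^ 2) • ∇ f y - (s * t) • (z - xs)) e
      + 3 / 2 * s ^ 2 * t ^ 2 * ‖e‖ ^ 2 := by
  have hg0 : ∇ f xs = 0 := gradient_eq_zero_of_forall_le hxs
  set g := ∇ f y with hg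
  set h := ∇ f x' with hh
  -- The three interpolation inequalities are later weighted by `t² - t`, `t` and `t²`.
  have h1 := hc.le_add_inner_gradient_sub_sq hL0 hf hL hs x y
  have h2 := hc.le_add_inner_gradient_sub_sq hL0 hf hL hs xs y
  have h3 := hc.le_add_inner_gradient_sub_sq hL0 hf hL hs y x'
  rw [hg0, zero_sub, norm_neg, ← hg] at h2
  rw [← hg] at h1
  have hx'y : x' - y = -(s • (g + e)) := by rw [hx']; abel
  rw [hx'y, ← hg, ← hh, inner_neg_right, inner_smul_right, inner_add_right,
    norm_sub_sq_real, real_inner_comm] at h3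
  -- The gradient `h` at the new point depends on `e`, so this product has no reason to average to
  -- zero; Young's inequality absorbs it into half of the available `‖h‖²`.
  have hhe : -(inner ℝ h e) ≤ ‖h‖ ^ 2 / 4 + ‖e‖ ^ 2 := by
    have := (neg_le_abs _).trans (abs_real_inner_le_norm h e)
    nlinarith [sq_nonneg (‖h‖ / 2 - ‖e‖)]
  have h4 : f x' ≤ f y - s / 4 * ‖h‖ ^ 2 - s / 2 * ‖g‖ ^ 2 + s * ‖e‖ ^ 2 := by
    nlinarith [mul_le_mul_of_nonneg_left hhe hs0.le, real_inner_comm g h]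
  have hzx : (t - 1) * inner ℝ g (y - x) + inner ℝ g (y - xs) = inner ℝ g (z - xs) := by
    rw [← inner_smul_right, ← inner_add_right]
    congr 1
    rw [hz]; module
  have h5 : t ^ 2 * (f x' - f xs) ≤ (t ^ 2 - t) * (f x - f xs) + t * inner ℝ g (z - xs)
      - s / 2 * (t ^ 2 - t) * ‖∇ f x - g‖ ^ 2 - s / 2 * t * ‖g‖ ^ 2
      - t ^ 2 * (s / 4 * ‖h‖ ^ 2 + s / 2 * ‖g‖ ^ 2 - s * ‖e‖ ^ 2) := by
    have a1 := mul_le_mul_of_nonneg_left h1 (by nlinarith : 0 ≤ t ^ 2 - t)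
    have a2 := mul_le_mul_of_nonneg_left h2 (by linarith : 0 ≤ t)
    have a4 := mul_le_mul_of_nonneg_left h4 (by positivity : 0 ≤ t ^ 2)
    rw [← hzx]
    nlinarith
  have h6 : (t ^ 2 - t) * (f x - f xs) ≤ t' ^ 2 * (f x - f xs) :=
    mul_le_mul_of_nonneg_right htt (sub_nonneg.2 (hxs x))
  have h7 : ‖z - (s * t) • (g + e) - xs‖ ^ 2 = ‖z - xs‖ ^ 2
      - 2 * (s * t) * (inner ℝ g (z - xs) + inner ℝ (z - xs) e)
      + (s * t) ^ 2 * (‖g‖ ^ 2 + 2 * inner ℝ g e + ‖e‖ ^ 2) := by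
    rw [sub_right_comm, norm_sub_sq_real, inner_smul_right, inner_add_right, norm_smul, mul_pow,
      norm_add_sq_real, Real.norm_eq_abs, sq_abs, real_inner_comm g (z - xs)]
    ring
  rw [h7, inner_sub_left ((s ^ 2 * t ^ 2) • g), real_inner_smul_left, real_inner_smul_left]
  -- The terms `s² t² ‖g‖² / 2` from the descent and from the expanded square cancel.
  nlinarith [mul_le_mul_of_nonneg_left (h5.trans (by linarith [h6] :
    _ ≤ t' ^ 2 * (f x - f xs) + t * inner ℝ g (z - xs)
      - s / 2 * (t ^ 2 - t) * ‖∇ f x - g‖ ^ 2 - s / 2 * t * ‖g‖ ^ 2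
      - t ^ 2 * (s / 4 * ‖h‖ ^ 2 + s / 2 * ‖g‖ ^ 2 - s * ‖e‖ ^ 2))) hs0.le]

end SmoothConvex

/-! ### The extrapolation sequence `t_k`. -/

section Extrapolation

variable {α : ℕ → ℝ}

theorem one_le_tSeq (hα : ∀ k, 0 ≤ α k) (k : ℕ) : 1 ≤ tSeq α k :=
  le_add_of_nonneg_right (tsum_nonneg fun _ => Finset.prod_nonneg fun j _ => hα j)

theorem tSeq_eq_one_add_mul (hK0 : CondK0 α) (k : ℕ) :
    tSeq α k = 1 + α k * tSeq α (k + 1) := by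
  have hp : ∀ n, ∏ j ∈ Finset.Icc k (k + (n + 1)), α j
      = α k * ∏ j ∈ Finset.Icc (k + 1) (k + 1 + n), α j := fun n => by
    rw [← Finset.mul_prod_Ioc_eq_prod_Icc (by omega)]
    congr 2
    ext j; simp only [Finset.mem_Ioc, Finset.mem_Icc]; omega
  have hs : Summable fun n : ℕ => ∏ j ∈ Finset.Icc k (k + n), α j := by
    rw [← summable_nat_add_iff 1]
    simp only [hp]
    exact (hK0 (k + 1) (by omega)).mul_left _
  have h0 : ∏ j ∈ Finset.Icc k (k + 0), α j = α k := by simp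
  unfold tSeq
  rw [hs.tsum_eq_zero_add, h0]
  simp only [hp, tsum_mul_left]
  ring

theorem CondK1Plus.sq_sub_le (h : CondK1Plus α) (hα : ∀ k, 0 ≤ α k) {k : ℕ} (hk : 1 ≤ k) :
    tSeq α (k + 1) ^ 2 - tSeq α (k + 1) ≤ tSeq α k ^ 2 := by
  obtain ⟨m, -, hm1, hm⟩ := h
  nlinarith [hm k hk, one_le_tSeq hα (k + 1)]

theorem CondK1Plus.succ_le_two_mul (h : CondK1Plus α) (hα : ∀ k, 0 ≤ α k) {k : ℕ} (hk : 1 ≤ k) :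
    tSeq α (k + 1) ≤ 2 * tSeq α k := by
  nlinarith [h.sq_sub_le hα hk, one_le_tSeq hα (k + 1), one_le_tSeq hα k]

end Extrapolation

/-! ### Almost supermartingales on decreasing events. -/

section LocalizedSupermartingale

variable {Ω : Type*} {mΩ : MeasurableSpace Ω} {P : Measure Ω}

theorem integrableOn_of_nonneg_of_le {D : Set Ω} {u v : Ω → ℝ} (hu : AEStronglyMeasurable u P)
    (hu0 : ∀ ω, 0 ≤ u ω) (huv : ∀ ω, u ω ≤ v ω) (hv : IntegrableOn v D P) : IntegrableOn u D P :=
  Integrable.mono' hv hu.restrict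
    (Eventually.of_forall fun ω => by rw [Real.norm_of_nonneg (hu0 ω)]; exact huv ω)

/-- Summed form of a localized almost supermartingale inequality. -/
theorem sum_setIntegral_le_of_almost_supermartingale {D : ℕ → Set Ω} (hD : Antitone D)
    {V u M N : ℕ → Ω → ℝ}
    (hVm : ∀ k, AEStronglyMeasurable (V k) P) (hum : ∀ k, AEStronglyMeasurable (u k) P)
    (hV0 : ∀ k ω, 0 ≤ V k ω) (hu0 : ∀ k ω, 0 ≤ u k ω)
    (hM : ∀ k, IntegrableOn (M k) (D k) P) (hM0 : ∀ k, ∫ ω in D k, M k ω ∂P = 0)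
    (hN : ∀ k, IntegrableOn (N k) (D k) P) (hV : IntegrableOn (V 0) (D 0) P)
    (hstep : ∀ k ω, V (k + 1) ω + u k ω ≤ V k ω + M k ω + N k ω) (n : ℕ) :
    IntegrableOn (V n) (D n) P ∧ (∀ k < n, IntegrableOn (u k) (D k) P) ∧
      ∫ ω in D n, V n ω ∂P + ∑ k ∈ Finset.range n, ∫ ω in D k, u k ω ∂P
        ≤ ∫ ω in D 0, V 0 ω ∂P + ∑ k ∈ Finset.range n, ∫ ω in D k, N k ω ∂P := by
  induction n with
  | zero => exact ⟨hV, by simp, by simp⟩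
  | succ n ih =>
    obtain ⟨ihV, ihu, ihs⟩ := ih
    -- Integrability propagates with the induction: this function dominates two nonnegative terms.
    -- Shrinking `D n` to `D (n + 1)` then only lowers the integral of the energy.
    have hR : IntegrableOn (fun ω => V n ω + M n ω + N n ω) (D n) P := (ihV.add (hM n)).add (hN n)
    have hVn : IntegrableOn (V (n + 1)) (D n) P :=
      integrableOn_of_nonneg_of_le (hVm _) (hV0 _)
        (fun ω => by linarith [hstep n ω, hu0 n ω]) hR
    have hun : IntegrableOn (u n) (D n) P :=
      integrableOn_of_nonneg_of_le (hum _) (hu0 _)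
        (fun ω => by linarith [hstep n ω, hV0 (n + 1) ω]) hR
    have hsub : D (n + 1) ⊆ D n := hD (Nat.le_succ n)
    refine ⟨hVn.mono_set hsub, fun k hk => ?_, ?_⟩
    · rcases Nat.lt_succ_iff_lt_or_eq.1 hk with h | rfl
      exacts [ihu k h, hun]
    have h1 : ∫ ω in D (n + 1), V (n + 1) ω ∂P ≤ ∫ ω in D n, V (n + 1) ω ∂P :=
      setIntegral_mono_set hVn (Eventually.of_forall (hV0 _)) hsub.eventuallyLE
    have h2 : ∫ ω in D n, V (n + 1) ω + u n ω ∂P ≤ ∫ ω in D n, V n ω + M n ω + N n ω ∂P :=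
      integral_mono (hVn.add hun) hR (hstep n)
    have h3 : ∫ ω in D n, V n ω + M n ω + N n ω ∂P
        = ∫ ω in D n, V n ω + M n ω ∂P + ∫ ω in D n, N n ω ∂P :=
      integral_add (ihV.add (hM n)) (hN n)
    rw [integral_add hVn hun, h3, integral_add ihV (hM n), hM0] at h2
    rw [Finset.sum_range_succ, Finset.sum_range_succ]
    linarith

/-- By Tonelli, the sum of the terms cut off to `D k` has finite expectation, hence is almost surely
finite; on `⋂ D k` the cut-offs do nothing. -/
theorem ae_summable_of_sum_setIntegral_le {D : ℕ → Set Ω} (hDm : ∀ k, MeasurableSet (D k))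
    {u : ℕ → Ω → ℝ} (hum : ∀ k, Measurable (u k)) (hu0 : ∀ k ω, 0 ≤ u k ω)
    (hu : ∀ k, IntegrableOn (u k) (D k) P) {C : ℝ}
    (hC : ∀ n, ∑ k ∈ Finset.range n, ∫ ω in D k, u k ω ∂P ≤ C) :
    ∀ᵐ ω ∂P, (∀ k, ω ∈ D k) → Summable fun k => u k ω := by
  have hm : ∀ k, Measurable ((D k).indicator fun ω => ENNReal.ofReal (u k ω)) := fun k =>
    (hum k).ennreal_ofReal.indicator (hDm k)
  have hfin : ∫⁻ ω, ∑' k, (D k).indicator (fun ω => ENNReal.ofReal (u k ω)) ω ∂P ≠ ∞ := by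
    rw [lintegral_tsum fun k => (hm k).aemeasurable]
    refine ne_top_of_le_ne_top (ENNReal.ofReal_ne_top (r := C))
      (ENNReal.tsum_le_of_sum_range_le fun n => ?_)
    calc ∑ k ∈ Finset.range n, ∫⁻ ω, (D k).indicator (fun ω => ENNReal.ofReal (u k ω)) ω ∂P
        = ∑ k ∈ Finset.range n, ENNReal.ofReal (∫ ω in D k, u k ω ∂P) :=
          Finset.sum_congr rfl fun k _ => by
            rw [lintegral_indicator (hDm k), ofReal_integral_eq_lintegral_ofReal (hu k)
              (Eventually.of_forall (hu0 k))]
      _ = ENNReal.ofReal (∑ k ∈ Finset.range n, ∫ ω in D k, u k ω ∂P) :=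
          (ENNReal.ofReal_sum_of_nonneg fun k _ => integral_nonneg (hu0 k)).symm
      _ ≤ ENNReal.ofReal C := ENNReal.ofReal_le_ofReal (hC n)
  filter_upwards [ae_lt_top (Measurable.tsum hm) hfin] with ω hω hωD
  have hω' : ∑' k, ENNReal.ofReal (u k ω) ≠ ∞ := by
    simpa [Set.indicator_of_mem (hωD _)] using hω.ne
  have := ENNReal.summable_toReal hω'
  simpa [ENNReal.toReal_ofReal (hu0 _ _)] using this

variable {H : Type*} [NormedAddCommGroup H] [InnerProductSpace ℝ H]

theorem integrable_inner_of_memLp_two {μ : Measure Ω} {ζ e : Ω → H} (hζ : MemLp ζ 2 μ)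
    (he : MemLp e 2 μ) : Integrable (fun ω => inner ℝ (ζ ω) (e ω)) μ :=
  Integrable.mono' (hζ.norm.integrable_mul he.norm) (hζ.1.inner he.1)
    (Eventually.of_forall fun _ => norm_inner_le_norm _ _)

/-- The factor measurable for `m` is pulled out of the conditional expectation. It is first
multiplied by the indicator of `D`, as square integrability is known only there. -/
theorem setIntegral_inner_eq_zero_of_condExp_eq_zero [CompleteSpace H] [IsFiniteMeasure P]
    {m : MeasurableSpace Ω} (hm : m ≤ mΩ) {D : Set Ω} (hD : MeasurableSet[m] D) {ζ e : Ω → H}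
    (hζm : StronglyMeasurable[m] ζ) (hζ : MemLp ζ 2 (P.restrict D))
    (he : MemLp e 2 (P.restrict D)) (hei : Integrable e P) (hce : P[e | m] =ᵐ[P] 0) :
    ∫ ω in D, inner ℝ (ζ ω) (e ω) ∂P = 0 := by
  have hind : (fun ω => innerSL ℝ (D.indicator ζ ω) (e ω))
      = D.indicator fun ω => inner ℝ (ζ ω) (e ω) := by
    ext ω; by_cases h : ω ∈ D <;> simp [h]
  have hint : Integrable (fun ω => innerSL ℝ (D.indicator ζ ω) (e ω)) P := by
    rw [hind, integrable_indicator_iff (hm _ hD)]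
    exact integrable_inner_of_memLp_two hζ he
  have h := condExp_bilin_of_stronglyMeasurable_left (m := m) (innerSL ℝ) (hζm.indicator hD)
    hint hei
  have h0 : P[fun ω => innerSL ℝ (D.indicator ζ ω) (e ω) | m] =ᵐ[P] 0 := by
    filter_upwards [h, hce] with ω h1 h2
    rw [h1, h2]; simp
  rw [← integral_indicator (hm _ hD), ← hind, ← integral_condExp hm, integral_congr_ae h0]
  simp

end LocalizedSupermartingale

/-! ### Localization by partial sums. -/

section LocalizingSets

variable {Ω : Type*}

/-- The event that the partial sum up to index `k` stays below the level `K`. -/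
def partialSumLe (a : ℕ → Ω → ℝ≥0∞) (K : ℝ≥0∞) (k : ℕ) : Set Ω :=
  {ω | ∑ j ∈ Finset.range (k + 1), a j ω ≤ K}

theorem antitone_partialSumLe (a : ℕ → Ω → ℝ≥0∞) (K : ℝ≥0∞) : Antitone (partialSumLe a K) :=
  fun _ _ hij ω hω => le_trans (Finset.sum_le_sum_of_subset (f := fun j => a j ω)
    (Finset.range_mono (Nat.succ_le_succ hij))) hω

theorem le_of_mem_partialSumLe {a : ℕ → Ω → ℝ≥0∞} {K : ℝ≥0∞} {j k : ℕ} (hjk : j ≤ k) {ω : Ω}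
    (hω : ω ∈ partialSumLe a K k) : a j ω ≤ K :=
  (Finset.single_le_sum (f := fun j => a j ω) (fun _ _ => zero_le)
    (Finset.mem_range.2 (by omega))).trans hω

theorem measurableSet_partialSumLe {m : MeasurableSpace Ω} {a : ℕ → Ω → ℝ≥0∞} {K : ℝ≥0∞} {k : ℕ}
    (ha : ∀ j ≤ k, Measurable (a j)) : MeasurableSet (partialSumLe a K k) :=
  measurableSet_le (Finset.measurable_fun_sum _ fun j hj => ha j (by
    have := Finset.mem_range.1 hj; omega)) measurable_const

theorem sum_indicator_partialSumLe_le (a : ℕ → Ω → ℝ≥0∞) (K : ℝ≥0∞) (n : ℕ) (ω : Ω) :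
    ∑ k ∈ Finset.range n, (partialSumLe a K k).indicator (a k) ω ≤ K := by
  induction n with
  | zero => simp
  | succ n ih =>
    -- On the event, the full partial sum is at most `K` by membership; off it, the last term
    -- vanishes.
    by_cases h : ω ∈ partialSumLe a K n
    · exact (Finset.sum_le_sum fun k _ => Set.indicator_le_self _ _ _).trans h
    · rw [Finset.sum_range_succ, Set.indicator_of_notMem h, add_zero]
      exact ih

/-- On the `k`-th event `a k ≤ K`, so `(a k)² ≤ K * a k`, and the localized sum of the `a k` is
again at most `K`. -/
theorem sum_setLIntegral_sq_partialSumLe_le {mΩ : MeasurableSpace Ω} (P : Measure Ω)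
    [IsProbabilityMeasure P] {a : ℕ → Ω → ℝ≥0∞} (ha : ∀ k, Measurable (a k)) (K : ℝ≥0∞) (n : ℕ) :
    ∑ k ∈ Finset.range n, ∫⁻ ω in partialSumLe a K k, a k ω ^ 2 ∂P ≤ K * K := by
  have hD : ∀ k, MeasurableSet (partialSumLe a K k) := fun k =>
    measurableSet_partialSumLe fun j _ => ha j
  calc ∑ k ∈ Finset.range n, ∫⁻ ω in partialSumLe a K k, a k ω ^ 2 ∂P
      = ∫⁻ ω, ∑ k ∈ Finset.range n, (partialSumLe a K k).indicator (fun ω => a k ω ^ 2) ω ∂P := by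
        rw [lintegral_finsetSum _ fun k _ => ((ha k).pow_const 2).indicator (hD k)]
        exact Finset.sum_congr rfl fun k _ => (lintegral_indicator (hD k) _).symm
    _ ≤ ∫⁻ _, K * K ∂P := by
        refine lintegral_mono fun ω => ?_
        calc _ ≤ ∑ k ∈ Finset.range n, K * (partialSumLe a K k).indicator (a k) ω := by
              refine Finset.sum_le_sum fun k _ => ?_
              by_cases h : ω ∈ partialSumLe a K k
              · rw [Set.indicator_of_mem h, Set.indicator_of_mem h, sq]
                gcongr
                exact le_of_mem_partialSumLe le_rfl h
              · simp [h]
          _ ≤ K * K := by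
              rw [← Finset.mul_sum]
              gcongr
              exact sum_indicator_partialSumLe_le a K n ω
    _ = K * K := by simp

end LocalizingSets

/-! ### The associated Nesterov iterates and their energy. -/

section StochasticRavine

variable {Ω H : Type*} [NormedAddCommGroup H]

/-- The sequence `w` of the Ravine method with its index shifted, starting from `w_{-1} = y_0`.
These are the iterates of the associated Nesterov method. -/
def nesterovIterate (y w : ℕ → Ω → H) : ℕ → Ω → H
  | 0 => y 0
  | n + 1 => w n

/-- The anchor sequence `x_n + t_{n+1} (x_{n+1} - x_n)` of the Nesterov iterates. -/
noncomputable def nesterovAnchor [NormedSpace ℝ H] (α : ℕ → ℝ) (y w : ℕ → Ω → H) (n : ℕ) (ω : Ω) :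
    H :=
  nesterovIterate y w n ω
    + tSeq α (n + 1) • (nesterovIterate y w (n + 1) ω - nesterovIterate y w n ω)

variable [InnerProductSpace ℝ H]

/-- The energy of the Nesterov iterates relative to a minimizer `xs`. -/
noncomputable def nesterovEnergy (f : H → ℝ) (s : ℝ) (α : ℕ → ℝ) (y w : ℕ → Ω → H) (xs : H) (n : ℕ)
    (ω : Ω) : ℝ :=
  s * tSeq α (n + 1) ^ 2 * (f (nesterovIterate y w (n + 1) ω) - f xs)
    + ‖nesterovAnchor α y w n ω - xs‖ ^ 2 / 2

theorem nesterovEnergy_nonneg {f : H → ℝ} {s : ℝ} {α : ℕ → ℝ} {y w : ℕ → Ω → H} {xs : H} (hs : 0 < s)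
    (hxs : ∀ z, f xs ≤ f z) (n : ℕ) (ω : Ω) :
    0 ≤ nesterovEnergy f s α y w xs n ω := by
  have := sub_nonneg.2 (hxs (nesterovIterate y w (n + 1) ω))
  unfold nesterovEnergy
  positivity

variable [CompleteSpace H]

/-- The decrease of `nesterovEnergy` between the steps `n` and `n + 1`, up to noise. -/
noncomputable def nesterovGain (f : H → ℝ) (s : ℝ) (α : ℕ → ℝ) (y w : ℕ → Ω → H) (n : ℕ) (ω : Ω) :
    ℝ :=
  s ^ 2 * tSeq α (n + 2) ^ 2 / 4 * ‖∇ f (nesterovIterate y w (n + 2) ω)‖ ^ 2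
    + s ^ 2 * (tSeq α (n + 2) ^ 2 - tSeq α (n + 2)) / 2
      * ‖∇ f (nesterovIterate y w (n + 1) ω) - ∇ f (y (n + 1) ω)‖ ^ 2
    + s ^ 2 * tSeq α (n + 2) / 2 * ‖∇ f (y (n + 1) ω)‖ ^ 2

/-- The predictable vector against which the noise is tested in the energy estimate. -/
noncomputable def nesterovDirection (f : H → ℝ) (s : ℝ) (α : ℕ → ℝ) (y w : ℕ → Ω → H) (xs : H)
    (n : ℕ) (ω : Ω) : H :=
  (s ^ 2 * tSeq α (n + 2) ^ 2) • ∇ f (y (n + 1) ω)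
    - (s * tSeq α (n + 2)) • (nesterovAnchor α y w n ω - xs)

variable {f : H → ℝ} {L : ℝ≥0} {s : ℝ} {α : ℕ → ℝ} {e y w : ℕ → Ω → H} {xs : H}

theorem IsSRAG.y_succ_eq (h : IsSRAG f s α e y w) (n : ℕ) (ω : Ω) :
    y (n + 1) ω = nesterovIterate y w (n + 1) ω
      + α (n + 1) • (nesterovIterate y w (n + 1) ω - nesterovIterate y w n ω) := by
  cases n with
  | zero => exact h.y_one ω
  | succ n => exact h.y_succ n ω

theorem nesterovGain_nonneg (hα : ∀ k, 0 ≤ α k) (n : ℕ) (ω : Ω) :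
    0 ≤ nesterovGain f s α y w n ω := by
  have ht := one_le_tSeq hα (n + 2)
  have : 0 ≤ tSeq α (n + 2) ^ 2 - tSeq α (n + 2) := by nlinarith
  unfold nesterovGain
  positivity

theorem IsSRAG.energy_step (h : IsSRAG f s α e y w) (hL0 : 0 < L)
    (hf : Differentiable ℝ f) (hc : ConvexOn ℝ Set.univ f) (hL : LipschitzWith L (∇ f))
    (hs0 : 0 < s) (hs : s ≤ 1 / (L : ℝ)) (hxs : ∀ z, f xs ≤ f z)
    (hα : ∀ k, 0 ≤ α k) (hK0 : CondK0 α) (hK1 : CondK1Plus α) (n : ℕ) (ω : Ω) :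
    nesterovEnergy f s α y w xs (n + 1) ω + nesterovGain f s α y w n ω
      ≤ nesterovEnergy f s α y w xs n ω
        + inner ℝ (nesterovDirection f s α y w xs n ω) (e (n + 1) ω)
        + 6 * ((s * tSeq α (n + 1)) ^ 2 * ‖e (n + 1) ω‖ ^ 2) := by
  have ht := one_le_tSeq hα (n + 2)
  have ht' := one_le_tSeq hα (n + 1)
  have hw : nesterovIterate y w (n + 2) ω
      = y (n + 1) ω - s • (∇ f (y (n + 1) ω) + e (n + 1) ω) := h.w_eq (n + 1) ω
  -- This identity rewrites the anchor through `y (n + 1)`, so that one step moves it only by a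
  -- multiple of the noisy gradient.
  have hαt : tSeq α (n + 2) * α (n + 1) = tSeq α (n + 1) - 1 := by
    rw [tSeq_eq_one_add_mul hK0 (n + 1)]; ring
  have hz : nesterovAnchor α y w n ω = nesterovIterate y w (n + 1) ω
      + tSeq α (n + 2) • (y (n + 1) ω - nesterovIterate y w (n + 1) ω) := by
    rw [h.y_succ_eq n ω, add_sub_cancel_left, smul_smul, hαt, nesterovAnchor]
    module
  have hz' : nesterovAnchor α y w (n + 1) ω = nesterovAnchor α y w n ω
      - (s * tSeq α (n + 2)) • (∇ f (y (n + 1) ω) + e (n + 1) ω) := by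
    rw [hz, nesterovAnchor, hw]
    module
  have hstep := hc.energy_step hL0 hf hL hs0 hs hxs ht (hK1.sq_sub_le hα (by omega : 1 ≤ n + 1))
    hw hz
  have htt := hK1.succ_le_two_mul hα (by omega : 1 ≤ n + 1)
  -- `(K₂⁺)` weights `e (n + 1)` by `t_{n+1}`, not `t_{n+2}`; the change costs a factor 4, whence 6.
  have hnoise : 3 / 2 * s ^ 2 * tSeq α (n + 2) ^ 2 * ‖e (n + 1) ω‖ ^ 2
      ≤ 6 * ((s * tSeq α (n + 1)) ^ 2 * ‖e (n + 1) ω‖ ^ 2) := by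
    have h1 : tSeq α (n + 2) ^ 2 ≤ 4 * tSeq α (n + 1) ^ 2 := by nlinarith
    have h2 : 0 ≤ 3 / 2 * s ^ 2 * ‖e (n + 1) ω‖ ^ 2 := by positivity
    nlinarith [mul_le_mul_of_nonneg_left h1 h2]
  rw [← hz'] at hstep
  unfold nesterovEnergy nesterovGain nesterovDirection
  linarith

/-- Split `t² = (t² - t) + t` and compare `∇f(y_{n+2})` with `∇f(x_{n+2})` in the first part: the
gain `n` controls the latter gradient, the gain `n + 1` the difference and the part of weight `t`.
-/
theorem summable_sq_mul_gradient_of_summable_gain (hs0 : 0 < s) (hα : ∀ k, 0 ≤ α k)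
    (hK1 : CondK1Plus α) {ω : Ω} (h : Summable fun n => nesterovGain f s α y w n ω) :
    Summable fun k : ℕ => tSeq α (k + 1) ^ 2 * ‖∇ f (y k ω)‖ ^ 2 := by
  rw [← summable_nat_add_iff 2]
  refine Summable.of_nonneg_of_le (fun k => by positivity) (fun n => ?_)
    ((h.mul_left (32 / s ^ 2)).add (((summable_nat_add_iff 1).2 h).mul_left (4 / s ^ 2)))
  have ht := one_le_tSeq hα (n + 3)
  have ht' := one_le_tSeq hα (n + 2)
  have htt := hK1.succ_le_two_mul hα (by omega : 1 ≤ n + 2)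
  simp only [nesterovGain, show n + 2 + 1 = n + 3 from rfl,  show n + 1 + 1 = n + 2 from rfl] at *
  set t := tSeq α (n + 3)
  set t' := tSeq α (n + 2)
  set g := ∇ f (y (n + 2) ω)
  set p := ∇ f (nesterovIterate y w (n + 2) ω)
  set A := ‖∇ f (nesterovIterate y w (n + 1) ω) - ∇ f (y (n + 1) ω)‖ ^ 2 with hA
  set B := ‖∇ f (y (n + 1) ω)‖ ^ 2 with hB
  have hA0 : 0 ≤ (t' ^ 2 - t') * A := mul_nonneg (by nlinarith) (by positivity)
  have hB0 : 0 ≤ t' * B := by positivity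
  have hC0 : 0 ≤ t ^ 2 * ‖∇ f (nesterovIterate y w (n + 3) ω)‖ ^ 2 := by positivity
  have hgp : ‖g‖ ^ 2 ≤ 2 * ‖p‖ ^ 2 + 2 * ‖p - g‖ ^ 2 := by
    have : ‖g‖ ≤ ‖p‖ + ‖p - g‖ := by
      simpa using norm_sub_le p (p - g)
    nlinarith [sq_nonneg (‖p‖ - ‖p - g‖), norm_nonneg g]
  have h1 : (t ^ 2 - t) * ‖g‖ ^ 2 ≤ (t ^ 2 - t) * (2 * ‖p‖ ^ 2 + 2 * ‖p - g‖ ^ 2) :=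
    mul_le_mul_of_nonneg_left hgp (by nlinarith)
  have h2 : (t ^ 2 - t) * (2 * ‖p‖ ^ 2) ≤ 4 * t' ^ 2 * (2 * ‖p‖ ^ 2) :=
    mul_le_mul_of_nonneg_right (by nlinarith) (by positivity)
  have hg0 : 0 ≤ t * ‖g‖ ^ 2 := by positivity
  calc t ^ 2 * ‖g‖ ^ 2
      ≤ 8 * t' ^ 2 * ‖p‖ ^ 2 + 16 * ((t' ^ 2 - t') * A) + 16 * (t' * B)
        + (t ^ 2 * ‖∇ f (nesterovIterate y w (n + 3) ω)‖ ^ 2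
          + 2 * ((t ^ 2 - t) * ‖p - g‖ ^ 2) + 2 * (t * ‖g‖ ^ 2)) := by linarith
    _ = _ := by field_simp; ring

theorem tendsto_gradient_of_summable (hα : ∀ k, 0 ≤ α k) {ω : Ω}
    (h : Summable fun k : ℕ => tSeq α (k + 1) ^ 2 * ‖∇ f (y k ω)‖ ^ 2) :
    Tendsto (fun k => ∇ f (y k ω)) atTop (𝓝 0) := by
  rw [tendsto_zero_iff_norm_tendsto_zero]
  have h2 : Tendsto (fun k => ‖∇ f (y k ω)‖ ^ 2) atTop (𝓝 0) :=
    squeeze_zero (fun _ => sq_nonneg _)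
      (fun k => le_mul_of_one_le_left (sq_nonneg _) (one_le_pow₀ (one_le_tSeq hα (k + 1))))
      h.tendsto_atTop_zero
  simpa using h2.sqrt

/-- A property of random vectors that is stable under linear combinations passes from
`w_i`, `i < k`, to the iterates up to index `k`. -/
theorem IsSRAG.property_of_forall_lt (h : IsSRAG f s α e y w) {p : (Ω → H) → Prop}
    (hadd : ∀ u v, p u → p v → p fun ω => u ω + v ω) (hsmul : ∀ (c : ℝ) u, p u → p fun ω => c • u ω)
    (hy : p (y 0)) {k : ℕ} (hw : ∀ i < k, p (w i)) {j : ℕ} (hj : j ≤ k) :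
    p (nesterovIterate y w j) ∧ p (y j) := by
  have hx : ∀ j ≤ k, p (nesterovIterate y w j) := by
    rintro (_ | j) hj
    exacts [hy, hw j (by omega)]
  refine ⟨hx j hj, ?_⟩
  cases j with
  | zero => exact hy
  | succ j =>
    have := hadd _ _ (hsmul (1 + α (j + 1)) _ (hx (j + 1) hj))
      (hsmul (-α (j + 1)) _ (hx j (by omega)))
    convert this using 2 with ω
    rw [h.y_succ_eq j ω]
    module

/-- A property of random vectors that is stable under linear combinations and under the gradient
passes from the errors to the iterates. -/
theorem IsSRAG.property_of_error (h : IsSRAG f s α e y w) {p : (Ω → H) → Prop}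
    (hadd : ∀ u v, p u → p v → p fun ω => u ω + v ω) (hsmul : ∀ (c : ℝ) u, p u → p fun ω => c • u ω)
    (hgrad : ∀ u, p u → p fun ω => ∇ f (u ω)) (hy : p (y 0)) {k : ℕ} (he : ∀ i < k, p (e i)) :
    ∀ i < k, p (w i) := by
  intro i
  induction i using Nat.strong_induction_on with
  | _ i ih =>
    intro hi
    have hyi := (h.property_of_forall_lt hadd hsmul hy (fun j hj => ih j hj (hj.trans hi)) le_rfl).2
    have := hadd _ _ hyi (hsmul (-s) _ (hadd _ _ (hgrad _ hyi) (he i hi)))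
    convert this using 2 with ω
    rw [h.w_eq i ω]
    module

end StochasticRavine

/-! ### Square integrability of the iterates. -/

section SquareIntegrability

variable {Ω H : Type*} [NormedAddCommGroup H] [InnerProductSpace ℝ H] [CompleteSpace H]
  {mΩ : MeasurableSpace Ω} {f : H → ℝ} {L : ℝ≥0} {s : ℝ} {α : ℕ → ℝ} {e y w : ℕ → Ω → H}

theorem MemLp.gradient_comp {μ : Measure Ω} [IsFiniteMeasure μ] (hL : LipschitzWith L (∇ f))
    {u : Ω → H} (hu : MemLp u 2 μ) : MemLp (fun ω => ∇ f (u ω)) 2 μ := by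
  have h0 : LipschitzWith L (fun x => ∇ f x - ∇ f 0) :=
    LipschitzWith.of_dist_le_mul fun a b => by simpa using hL.dist_le_mul a b
  convert (h0.comp_memLp (by simp) hu).add (memLp_const (∇ f 0)) using 1
  ext ω
  simp

theorem IsSRAG.memLp (h : IsSRAG f s α e y w) {μ : Measure Ω} [IsFiniteMeasure μ]
    (hL : LipschitzWith L (∇ f)) (hy : MemLp (y 0) 2 μ) {k : ℕ} (he : ∀ i < k, MemLp (e i) 2 μ)
    {j : ℕ} (hj : j ≤ k) : MemLp (nesterovIterate y w j) 2 μ ∧ MemLp (y j) 2 μ := by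
  have hadd : ∀ u v : Ω → H, MemLp u 2 μ → MemLp v 2 μ → MemLp (fun ω => u ω + v ω) 2 μ :=
    fun _ _ hu hv => hu.add hv
  have hsmul : ∀ (c : ℝ) (u : Ω → H), MemLp u 2 μ → MemLp (fun ω => c • u ω) 2 μ :=
    fun c _ hu => hu.const_smul c
  exact h.property_of_forall_lt hadd hsmul hy
    (h.property_of_error (p := fun u => MemLp u 2 μ) hadd hsmul
      (fun _ hu => MemLp.gradient_comp hL hu) hy he) hj

theorem IsSRAG.memLp_nesterovAnchor (h : IsSRAG f s α e y w) {μ : Measure Ω} [IsFiniteMeasure μ]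
    (hL : LipschitzWith L (∇ f)) (hy : MemLp (y 0) 2 μ) {n : ℕ} (he : ∀ i < n + 1, MemLp (e i) 2 μ) :
    MemLp (nesterovAnchor α y w n) 2 μ :=
  have hx := (h.memLp hL hy he (Nat.le_succ n)).1
  hx.add (((h.memLp hL hy he le_rfl).1.sub hx).const_smul _)

theorem IsSRAG.memLp_nesterovDirection (h : IsSRAG f s α e y w) {μ : Measure Ω}
    [IsFiniteMeasure μ] (hL : LipschitzWith L (∇ f)) (hy : MemLp (y 0) 2 μ) (xs : H) {n : ℕ}
    (he : ∀ i < n + 1, MemLp (e i) 2 μ) : MemLp (nesterovDirection f s α y w xs n) 2 μ :=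
  ((MemLp.gradient_comp hL (h.memLp hL hy he le_rfl).2).const_smul _).sub
    (((h.memLp_nesterovAnchor hL hy he).sub (memLp_const xs)).const_smul _)

end SquareIntegrability

/-! ### Measurability along the filtration and integrability of the energy. -/

section Filtration

variable {Ω H : Type*} [MeasurableSpace H]

theorem sragSigma_mono (y w : ℕ → Ω → H) : Monotone (sragSigma y w) := fun _ _ hij =>
  sup_le le_sup_left (iSup_le fun a => le_sup_of_le_right
    (le_iSup (fun i => MeasurableSpace.comap (w (i : Fin _)) inferInstance) (Fin.castLE hij a)))

theorem measurable_sragSigma_zero (y w : ℕ → Ω → H) (k : ℕ) : Measurable[sragSigma y w k] (y 0) :=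
  (comap_measurable (y 0)).mono le_sup_left le_rfl

theorem measurable_sragSigma_of_lt (y w : ℕ → Ω → H) {i k : ℕ} (hi : i < k) :
    Measurable[sragSigma y w k] (w i) :=
  (comap_measurable (w i)).mono (le_sup_of_le_right
    (le_iSup (fun i : Fin k => MeasurableSpace.comap (w i) inferInstance) ⟨i, hi⟩)) le_rfl

variable [NormedAddCommGroup H] [InnerProductSpace ℝ H] {f : H → ℝ} {L : ℝ≥0} {s : ℝ} {α : ℕ → ℝ}
  {e y w : ℕ → Ω → H} {xs : H} [CompleteSpace H] [TopologicalSpace.SeparableSpace H] [BorelSpace H]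

theorem IsSRAG.measurable_sragSigma (h : IsSRAG f s α e y w) {j k : ℕ} (hj : j ≤ k) :
    Measurable[sragSigma y w k] (nesterovIterate y w j) ∧ Measurable[sragSigma y w k] (y j) := by
  have : SecondCountableTopology H := UniformSpace.secondCountable_of_separable H
  exact h.property_of_forall_lt (p := fun u => Measurable[sragSigma y w k] u)
    (fun _ _ hu hv => Measurable.add hu hv) (fun c _ hu => Measurable.const_smul hu c)
    (measurable_sragSigma_zero y w k) (fun i hi => measurable_sragSigma_of_lt y w hi) hj

theorem IsSRAG.measurable_nesterovDirection (h : IsSRAG f s α e y w)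
    (hL : LipschitzWith L (∇ f)) (xs : H) (n : ℕ) :
    Measurable[sragSigma y w (n + 1)] (nesterovDirection f s α y w xs n) := by
  have : SecondCountableTopology H := UniformSpace.secondCountable_of_separable H
  have hx := (h.measurable_sragSigma (j := n) (k := n + 1) (by omega)).1
  have hx' := (h.measurable_sragSigma (j := n + 1) (k := n + 1) le_rfl).1
  have hg := hL.continuous.measurable.comp (h.measurable_sragSigma (j := n + 1) (k := n + 1) le_rfl).2
  exact (hg.const_smul _).sub
    (((hx.add ((hx'.sub hx).const_smul _)).sub measurable_const).const_smul _)

variable {mΩ : MeasurableSpace Ω}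

theorem IsSRAG.measurable_w (h : IsSRAG f s α e y w) (hL : LipschitzWith L (∇ f))
    (he : ∀ k, Measurable (e k)) (hy : Measurable (y 0)) (k : ℕ) : Measurable (w k) := by
  have : SecondCountableTopology H := UniformSpace.secondCountable_of_separable H
  exact h.property_of_error (p := fun u => Measurable u) (fun _ _ hu hv => hu.add hv)
    (fun c _ hu => hu.const_smul c) (fun _ hu => hL.continuous.measurable.comp hu) hy
    (fun i _ => he i) k (Nat.lt_succ_self k)

theorem IsSRAG.sragSigma_le (h : IsSRAG f s α e y w) (hL : LipschitzWith L (∇ f))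
    (he : ∀ k, Measurable (e k)) (hy : Measurable (y 0)) (k : ℕ) : sragSigma y w k ≤ mΩ :=
  sup_le hy.comap_le (iSup_le fun _ => (h.measurable_w hL he hy _).comap_le)

theorem IsSRAG.measurable_nesterovEnergy (h : IsSRAG f s α e y w) (hf : Differentiable ℝ f)
    (hL : LipschitzWith L (∇ f)) (he : ∀ k, Measurable (e k)) (hy : Measurable (y 0)) (xs : H)
    (n : ℕ) : Measurable (nesterovEnergy f s α y w xs n) := by
  have : SecondCountableTopology H := UniformSpace.secondCountable_of_separable H
  have hx : ∀ j, Measurable (nesterovIterate y w j) := fun j =>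
    (h.measurable_sragSigma le_rfl).1.mono (h.sragSigma_le hL he hy j) le_rfl
  have hz : Measurable (nesterovAnchor α y w n) :=
    (hx n).add (((hx (n + 1)).sub (hx n)).const_smul _)
  exact (((hf.continuous.measurable.comp (hx (n + 1))).sub_const _).const_mul _).add
    (((hz.sub_const xs).norm.pow_const 2).div_const 2)

theorem IsSRAG.measurable_nesterovGain (h : IsSRAG f s α e y w)
    (hL : LipschitzWith L (∇ f)) (he : ∀ k, Measurable (e k)) (hy : Measurable (y 0))
    (n : ℕ) : Measurable (nesterovGain f s α y w n) := by
  have : SecondCountableTopology H := UniformSpace.secondCountable_of_separable H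
  have hx : ∀ j, Measurable fun ω => ∇ f (nesterovIterate y w j ω) := fun j =>
    hL.continuous.measurable.comp
      ((h.measurable_sragSigma le_rfl).1.mono (h.sragSigma_le hL he hy j) le_rfl)
  have hg : Measurable fun ω => ∇ f (y (n + 1) ω) :=
    hL.continuous.measurable.comp
      ((h.measurable_sragSigma le_rfl).2.mono (h.sragSigma_le hL he hy (n + 1)) le_rfl)
  exact ((((hx (n + 2)).norm.pow_const 2).const_mul _).add
    ((((hx (n + 1)).sub hg).norm.pow_const 2).const_mul _)).add ((hg.norm.pow_const 2).const_mul _)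

/-- The descent lemma at the minimizer bounds `f - f xs` by `L / 2` times the squared distance to
`xs`. -/
theorem IsSRAG.integrable_nesterovEnergy (h : IsSRAG f s α e y w) {μ : Measure Ω}
    [IsFiniteMeasure μ] (hf : Differentiable ℝ f) (hL : LipschitzWith L (∇ f)) (hs : 0 < s)
    (hxs : ∀ z, f xs ≤ f z) (he : ∀ k, Measurable (e k)) (hy : Measurable (y 0))
    (hy2 : MemLp (y 0) 2 μ) {n : ℕ} (he2 : ∀ i < n + 1, MemLp (e i) 2 μ) :
    Integrable (nesterovEnergy f s α y w xs n) μ := by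
  have hx := (h.memLp hL hy2 he2 le_rfl).1.sub (memLp_const xs)
  have hz := (h.memLp_nesterovAnchor hL hy2 he2).sub (memLp_const xs)
  have hbound : Integrable (fun ω => s * tSeq α (n + 1) ^ 2
      * (L / 2 * ‖nesterovIterate y w (n + 1) ω - xs‖ ^ 2)
      + ‖nesterovAnchor α y w n ω - xs‖ ^ 2 / 2) μ :=
    (((memLp_two_iff_integrable_sq_norm hx.1).1 hx).const_mul _ |>.const_mul _).add
      (((memLp_two_iff_integrable_sq_norm hz.1).1 hz).div_const 2)
  refine hbound.mono' (h.measurable_nesterovEnergy hf hL he hy xs n).aestronglyMeasurable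
    (Eventually.of_forall fun ω => ?_)
  rw [Real.norm_of_nonneg (nesterovEnergy_nonneg hs hxs n ω)]
  have := le_add_inner_gradient_add_sq hf hL xs (nesterovIterate y w (n + 1) ω)
  rw [gradient_eq_zero_of_forall_le hxs, inner_zero_left, add_zero] at this
  unfold nesterovEnergy
  gcongr
  linarith

end Filtration

/-! ### Second moments of the localized noise. -/

section Noise

variable {Ω H : Type*} [NormedAddCommGroup H] [MeasurableSpace H]
  {mΩ : MeasurableSpace Ω} {P : Measure Ω} {s : ℝ} {α : ℕ → ℝ} {e y w : ℕ → Ω → H}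

/-- The weighted conditional standard deviation `s t_k σ_k`. -/
noncomputable def sragWeight (P : Measure Ω) (s : ℝ) (α : ℕ → ℝ) (e y w : ℕ → Ω → H) (k : ℕ)
    (ω : Ω) : ℝ≥0∞ :=
  ENNReal.ofReal (s * tSeq α k) * sragSd P e y w k ω

theorem measurable_sragWeight (k : ℕ) :
    Measurable[sragSigma y w k] (sragWeight P s α e y w k) :=
  ((measurable_condLExp _ P _).pow_const _).const_mul _

/-- The `k`-th weight is itself `F_k`-measurable, so the event may include it and still be used to
localize `e k` without destroying its zero conditional mean. -/
theorem measurableSet_sragSigma_partialSumLe (K : ℝ≥0∞) (k : ℕ) :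
    MeasurableSet[sragSigma y w k] (partialSumLe (sragWeight P s α e y w) K k) :=
  measurableSet_partialSumLe fun j hj =>
    (measurable_sragWeight j).mono (sragSigma_mono y w hj) le_rfl

theorem setLIntegral_sragWeight_sq [IsFiniteMeasure P] {k : ℕ} (hm : sragSigma y w k ≤ mΩ)
    {D : Set Ω} (hD : MeasurableSet[sragSigma y w k] D) :
    ∫⁻ ω in D, sragWeight P s α e y w k ω ^ 2 ∂P
      = ENNReal.ofReal (s * tSeq α k) ^ 2 * ∫⁻ ω in D, ‖e k ω‖ₑ ^ 2 ∂P := by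
  rw [← setLIntegral_condLExp hm P (fun ω => ‖e k ω‖ₑ ^ 2) hD, ← lintegral_const_mul _
    ((measurable_condLExp _ P _).mono hm le_rfl)]
  refine lintegral_congr fun ω => ?_
  rw [sragWeight, sragSd, mul_pow, ← ENNReal.rpow_natCast (_ ^ (1 / 2 : ℝ)), ← ENNReal.rpow_mul]
  norm_num

variable [IsProbabilityMeasure P]

theorem setLIntegral_error_ne_top (hs : 0 < s) (hα : ∀ k, 0 ≤ α k)
    (hm : ∀ k, sragSigma y w k ≤ mΩ) {K : ℝ≥0∞} (hK : K ≠ ∞) (k : ℕ) :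
    ∫⁻ ω in partialSumLe (sragWeight P s α e y w) K k, ‖e k ω‖ₑ ^ 2 ∂P ≠ ∞ := by
  have h := sum_setLIntegral_sq_partialSumLe_le P (a := sragWeight P s α e y w)
    (fun k => (measurable_sragWeight k).mono (hm k) le_rfl) K (k + 1)
  have h1 := (Finset.single_le_sum (fun _ _ => zero_le) (Finset.self_mem_range_succ k)).trans h
  rw [setLIntegral_sragWeight_sq (hm k) (measurableSet_sragSigma_partialSumLe K k)] at h1
  have ht := one_le_tSeq hα k
  have hst : 0 < s * tSeq α k := by positivity
  exact (ENNReal.lt_top_of_mul_ne_top_right (ne_top_of_le_ne_top (ENNReal.mul_ne_top hK hK) h1)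
    (by simpa using hst)).ne

theorem memLp_error (hs : 0 < s) (hα : ∀ k, 0 ≤ α k) (hm : ∀ k, sragSigma y w k ≤ mΩ)
    (he : ∀ k, AEStronglyMeasurable (e k) P) {K : ℝ≥0∞} (hK : K ≠ ∞) {j k : ℕ} (hjk : j ≤ k) :
    MemLp (e j) 2 (P.restrict (partialSumLe (sragWeight P s α e y w) K k)) := by
  have hj : MemLp (e j) 2 (P.restrict (partialSumLe (sragWeight P s α e y w) K j)) := by
    refine ⟨(he j).restrict, ?_⟩
    rw [eLpNorm_lt_top_iff_lintegral_rpow_enorm_lt_top (by simp) (by simp)]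
    simpa using (setLIntegral_error_ne_top hs hα hm hK j).lt_top
  exact hj.mono_measure (Measure.restrict_mono_set _ (antitone_partialSumLe _ _ hjk))

theorem sum_setIntegral_error_le (hs : 0 < s) (hα : ∀ k, 0 ≤ α k) (hm : ∀ k, sragSigma y w k ≤ mΩ)
    (he : ∀ k, AEStronglyMeasurable (e k) P) (K : ℕ) (n : ℕ) :
    ∑ k ∈ Finset.range n, ∫ ω in partialSumLe (sragWeight P s α e y w) K k,
      (s * tSeq α k) ^ 2 * ‖e k ω‖ ^ 2 ∂P ≤ (K : ℝ) * K := by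
  have h := sum_setLIntegral_sq_partialSumLe_le P (a := sragWeight P s α e y w)
    (fun k => (measurable_sragWeight k).mono (hm k) le_rfl) K n
  rw [← ENNReal.ofReal_le_ofReal_iff (by positivity),
    ENNReal.ofReal_sum_of_nonneg fun k _ => integral_nonneg fun ω => by positivity]
  refine le_trans (le_of_eq (Finset.sum_congr rfl fun k _ => ?_)) (h.trans_eq ?_)
  · have he2 := memLp_error hs hα hm he (ENNReal.natCast_ne_top K) (le_refl k)
    rw [setLIntegral_sragWeight_sq (hm k) (measurableSet_sragSigma_partialSumLe _ k),
      ofReal_integral_eq_lintegral_ofReal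
        (((memLp_two_iff_integrable_sq_norm he2.1).1 he2).const_mul _)
        (Eventually.of_forall fun ω => by positivity),
      ← lintegral_const_mul' _ _ (by simp)]
    refine lintegral_congr fun ω => ?_
    have ht := one_le_tSeq hα k
    rw [ENNReal.ofReal_mul (by positivity), ENNReal.ofReal_pow (by positivity),
      ENNReal.ofReal_pow (norm_nonneg _), ofReal_norm]
  · rw [ENNReal.ofReal_mul (by positivity), ENNReal.ofReal_natCast]

end Noise

theorem IsSRAG.ae_summable_nesterovGain
    {H : Type*} [NormedAddCommGroup H] [InnerProductSpace ℝ H] [CompleteSpace H]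
    [TopologicalSpace.SeparableSpace H] [MeasurableSpace H] [BorelSpace H]
    {Ω : Type*} [MeasurableSpace Ω] {P : Measure Ω} [IsProbabilityMeasure P]
    {f : H → ℝ} {L : ℝ≥0} {s : ℝ} {α : ℕ → ℝ} {e y w : ℕ → Ω → H} {xs : H}
    (h : IsSRAG f s α e y w) (hL0 : 0 < L)
    (hf : Differentiable ℝ f) (hc : ConvexOn ℝ Set.univ f) (hL : LipschitzWith L (∇ f))
    (hs0 : 0 < s) (hs : s ≤ 1 / (L : ℝ)) (hxs : ∀ z, f xs ≤ f z)
    (hα : ∀ k, 0 ≤ α k) (hK0 : CondK0 α) (hK1 : CondK1Plus α)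
    (he : ∀ k, Measurable (e k)) (hy : Measurable (y 0)) (hy2 : MemLp (y 0) 2 P)
    (hK2 : CondK2Plus P s α e y w) (K : ℕ) :
    ∀ᵐ ω ∂P, (∀ k, ω ∈ partialSumLe (sragWeight P s α e y w) K k) →
      Summable fun n => nesterovGain f s α y w n ω := by
  have : SecondCountableTopology H := UniformSpace.secondCountable_of_separable H
  have hm := h.sragSigma_le hL he hy
  have hem : ∀ k, AEStronglyMeasurable (e k) P := fun k => (he k).aestronglyMeasurable
  set D := partialSumLe (sragWeight P s α e y w) K with hDdef
  have hDF : ∀ k, MeasurableSet[sragSigma y w k] (D k) := measurableSet_sragSigma_partialSumLe _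
  have hDm : ∀ k, MeasurableSet (D k) := fun k => hm k _ (hDF k)
  have he2 : ∀ {j k}, j ≤ k → MemLp (e j) 2 (P.restrict (D k)) :=
    memLp_error hs0 hα hm hem (ENNReal.natCast_ne_top K)
  have hy2' : ∀ k, MemLp (y 0) 2 (P.restrict (D k)) := fun k => hy2.restrict _
  have hζ : ∀ n, MemLp (nesterovDirection f s α y w xs n) 2 (P.restrict (D (n + 1))) := fun n =>
    h.memLp_nesterovDirection hL (hy2' _) xs fun i hi => he2 hi.le
  have hN : ∀ k, IntegrableOn (fun ω => (s * tSeq α k) ^ 2 * ‖e k ω‖ ^ 2) (D k) P := fun k =>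
    ((memLp_two_iff_integrable_sq_norm (he2 le_rfl).1).1 (he2 le_rfl)).const_mul _
  -- Step `n` involves the noise `e (n + 1)`, hence the shifted events.
  have key := sum_setIntegral_le_of_almost_supermartingale (P := P) (D := fun n => D (n + 1))
    (V := nesterovEnergy f s α y w xs) (u := nesterovGain f s α y w)
    (M := fun n ω => inner ℝ (nesterovDirection f s α y w xs n ω) (e (n + 1) ω))
    (N := fun n ω => 6 * ((s * tSeq α (n + 1)) ^ 2 * ‖e (n + 1) ω‖ ^ 2))
    (fun i j hij => antitone_partialSumLe _ _ (Nat.succ_le_succ hij))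
    (fun n => (h.measurable_nesterovEnergy hf hL he hy xs n).aestronglyMeasurable)
    (fun n => (h.measurable_nesterovGain hL he hy n).aestronglyMeasurable)
    (nesterovEnergy_nonneg hs0 hxs) (nesterovGain_nonneg hα)
    (fun n => integrable_inner_of_memLp_two (hζ n) (he2 le_rfl))
    (fun n => setIntegral_inner_eq_zero_of_condExp_eq_zero (hm (n + 1)) (hDF (n + 1))
      (h.measurable_nesterovDirection hL xs n).stronglyMeasurable (hζ n) (he2 le_rfl)
      (hK2.integrable _) (hK2.condExp_eq_zero _))
    (fun n => (hN (n + 1)).const_mul 6)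
    (h.integrable_nesterovEnergy hf hL hs0 hxs he hy (hy2' _) fun i hi => he2 hi.le)
    (h.energy_step hL0 hf hc hL hs0 hs hxs hα hK0 hK1)
  have hsum := ae_summable_of_sum_setIntegral_le (P := P) (D := fun n => D (n + 1))
    (fun n => hDm (n + 1)) (h.measurable_nesterovGain hL he hy) (nesterovGain_nonneg hα)
    (fun n => (key (n + 1)).2.1 n (Nat.lt_succ_self n))
    (C := ∫ ω in D 1, nesterovEnergy f s α y w xs 0 ω ∂P + 6 * ((K : ℝ) * K)) fun n => by
      have h1 := (key n).2.2
      have h2 : 0 ≤ ∫ ω in D (n + 1), nesterovEnergy f s α y w xs n ω ∂P :=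
        integral_nonneg (nesterovEnergy_nonneg hs0 hxs n)
      have h3 := sum_setIntegral_error_le hs0 hα hm hem K (n + 1)
      rw [Finset.sum_range_succ'] at h3
      have h4 : 0 ≤ ∫ ω in D 0, (s * tSeq α 0) ^ 2 * ‖e 0 ω‖ ^ 2 ∂P :=
        integral_nonneg fun ω => by positivity
      simp only [integral_const_mul (6 : ℝ), ← Finset.mul_sum] at h1
      linarith
  filter_upwards [hsum] with ω hω hωD
  exact hω fun k => hωD (k + 1)

theorem theorem4p3
    {H : Type*} [NormedAddCommGroup H] [InnerProductSpace ℝ H] [CompleteSpace H]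
    [TopologicalSpace.SeparableSpace H] [MeasurableSpace H] [BorelSpace H]
    {Ω : Type*} [MeasurableSpace Ω] (P : Measure Ω) [IsProbabilityMeasure P]
    (f : H → ℝ) (L : ℝ≥0) (hL : 0 < L)
    (hf_diff : Differentiable ℝ f) (hf_conv : ConvexOn ℝ Set.univ f)
    (hf_lip : LipschitzWith L (∇ f)) (hf_min : ∃ x : H, ∀ z : H, f x ≤ f z)
    (s : ℝ) (hs_pos : 0 < s) (hs_le : s ≤ 1 / (L : ℝ))
    (α : ℕ → ℝ) (hα : ∀ k, α k ∈ Set.Icc (0 : ℝ) 1)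
    (hK0 : CondK0 α) (hK1 : CondK1Plus α)
    (e y w : ℕ → Ω → H) (he_meas : ∀ k, Measurable (e k))
    (hy0_meas : Measurable (y 0)) (hy0_sq : MemLp (y 0) 2 P)
    (hsrag : IsSRAG f s α e y w) (hK2 : CondK2Plus P s α e y w) :
    ∀ᵐ ω ∂P,
      Tendsto (fun k => ∇ f (y k ω)) atTop (𝓝 0) ∧
      Summable (fun k : ℕ => tSeq α (k + 1) ^ 2 * ‖∇ f (y k ω)‖ ^ 2) := by
  obtain ⟨xs, hxs⟩ := hf_min
  have hα0 : ∀ k, 0 ≤ α k := fun k => (hα k).1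
  have hgain := ae_all_iff.2 fun K : ℕ => hsrag.ae_summable_nesterovGain hL hf_diff hf_conv hf_lip
    hs_pos hs_le hxs hα0 hK0 hK1 he_meas hy0_meas hy0_sq hK2 K
  filter_upwards [hgain, hK2.summable] with ω hω hfin
  -- A level above the total sum puts `ω` in every localizing event.
  obtain ⟨K, hK⟩ := ENNReal.exists_nat_gt hfin.ne
  have hsum := summable_sq_mul_gradient_of_summable_gain hs_pos hα0 hK1
    (hω K fun k => (ENNReal.sum_le_tsum _).trans hK.le)
  exact ⟨tendsto_gradient_of_summable hα0 hsum, hsum⟩
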